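/- Let $S$ be a finite nonempty alphabet. A \emph{pattern} is a map $s : D \to S$ with $D \subset \mathbb{Z}^2$ finite; it \emph{occurs} in a configuration $x \in S^{\mathbb{Z}^2}$ if there is $v \in \mathbb{Z}^2$ with $x_{v+u} = s(u)$ for all $u \in D$. A \emph{two-dimensional SFT} is a set $X \subset S^{\mathbb{Z}^2}$ of the form $X = \{x : \text{no pattern of } \mathcal{F} \text{ occurs in } x\}$ for a finite set $\mathcal{F}$ of patterns. For configurations $x, y$ write $x \succcurlyeq y$ if every pattern that occurs in $y$ occurs in $x$, and $x \approx y$ if $x \succcurlyeq y$ and $y \succcurlyeq x$. The \emph{subpattern poset} of $X$ is $(X/{\approx}, \succcurlyeq)$; a poset is \emph{nontrivial} if it has at least two elements. A configuration $x$ is \emph{periodic} if there is an integer $r > 0$ with $x_{u + (r,0)} = x_u = x_{u + (0,r)}$ for all $u \in \mathbb{Z}^2$. Let $X$ be a countable two-dimensional SFT. If the subpattern poset of $X$ is nontrivial, then $X$ contains two periodic points $x, y$ with $x \not\approx y$. Moreover, the subpattern poset of $X$ is not order-isomorphic to any nontrivial lattice. -/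

import Mathlib

open SymbolicDynamics.FullShift

namespace SubpatternOrder

/-- The pattern `p` occurs in the configuration `x`: for some vector `v`, the symbols of `x` on
the domain of `p` translated by `v` are those of `p`. -/
def Occurs {S : Type*} [Inhabited S] {d : ℕ} (p : Pattern S (Fin d → ℤ))
    (x : (Fin d → ℤ) → S) : Prop :=
  ∃ v : Fin d → ℤ, p.occursInAt x v

/-- The subpattern order `x ≽ y`: every pattern that occurs in `y` occurs in `x`. -/
def Dominates {S : Type*} [Inhabited S] {d : ℕ} (x y : (Fin d → ℤ) → S) : Prop :=
  ∀ p : Pattern S (Fin d → ℤ), Occurs p y → Occurs p x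

/-- The relation `x ≈ y`: both `x ≽ y` and `y ≽ x`. -/
def Equivalent {S : Type*} [Inhabited S] {d : ℕ} (x y : (Fin d → ℤ) → S) : Prop :=
  Dominates x y ∧ Dominates y x

/-- A configuration is periodic if for some `r > 0` it is invariant under the translation by `r`
in each of the `d` coordinate directions. -/
def IsPeriodic {S : Type*} {d : ℕ} (x : (Fin d → ℤ) → S) : Prop :=
  ∃ r : ℕ, 0 < r ∧ ∀ k : Fin d, shift (Pi.single k (r : ℤ)) x = x

/-- A subshift is of finite type if it is defined by a finite set of forbidden patterns. -/
def IsSFT {S : Type*} [Inhabited S] [TopologicalSpace S] {d : ℕ}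
    (X : Subshift S (Fin d → ℤ)) : Prop :=
  ∃ F : Set (Pattern S (Fin d → ℤ)), F.Finite ∧ X.carrier = forbidden F

/-- The points of a subshift, as a type that carries the subpattern order. -/
structure Point {S : Type*} [TopologicalSpace S] {d : ℕ} (X : Subshift S (Fin d → ℤ)) where
  val : (Fin d → ℤ) → S
  mem : val ∈ X.carrier

/-- The subpattern order on the points of a subshift, where `y ≤ x` means `x ≽ y`. -/
instance {S : Type*} [Inhabited S] [TopologicalSpace S] {d : ℕ}
    (X : Subshift S (Fin d → ℤ)) : Preorder (Point X) where
  le y x := Dominates x.val y.val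
  le_refl _ _ h := h
  le_trans _ _ _ hab hbc p hp := hbc p (hab p hp)

/-- The subpattern poset of a subshift: its points modulo `≈`, ordered by `≽`. -/
abbrev SubpatternPoset {S : Type*} [Inhabited S] [TopologicalSpace S] {d : ℕ}
    (X : Subshift S (Fin d → ℤ)) : Type _ :=
  Antisymmetrization (Point X) (· ≤ ·)

theorem toAntisymmetrization_le_iff {S : Type*} [Inhabited S] [TopologicalSpace S] {d : ℕ}
    (X : Subshift S (Fin d → ℤ)) (x y : Point X) :
    (toAntisymmetrization (· ≤ ·) y : SubpatternPoset X) ≤ toAntisymmetrization (· ≤ ·) x ↔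
      Dominates x.val y.val :=
  Iff.rfl

theorem toAntisymmetrization_eq_iff {S : Type*} [Inhabited S] [TopologicalSpace S] {d : ℕ}
    (X : Subshift S (Fin d → ℤ)) (x y : Point X) :
    (toAntisymmetrization (· ≤ ·) x : SubpatternPoset X) = toAntisymmetrization (· ≤ ·) y ↔
      Equivalent x.val y.val :=
  le_antisymm_iff.trans and_comm

end SubpatternOrder

namespace SubpatternOrder

/-! A periodic point has a finite orbit, so whatever it dominates lies in that orbit
(`mem_orbit_of_dominates`): its class is minimal. Two inequivalent periodic points thus have no
common lower bound, which excludes a lattice. It remains to find two.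

Countability enters through `exists_orbit_diff_finite` (Zorn and Baire). With `O` empty it yields a
point of finite orbit, hence a periodic point `p`. With `O` the orbit of `p` it yields `z` outside
`O` such that only finitely many translates of `z` fail to look like `p` near the origin. If `z` has
no nonzero period, it differs from a translate of `p` in a bounded region; if its periods span one
direction, it agrees with translates of `p` on both sides of a strip. Since the constraints have
finite range, the defect can be repeated periodically (`glue`), which gives a periodic point outside
the orbit of `p`. -/

theorem shift_neg_shift {S G : Type*} [AddGroup G] (v : G) (x : G → S) :
    shift (-v) (shift v x) = x := by
  ext w; simp

/-! ### Isolated points and minimal subsystems of countable subshifts -/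

section Isolated

variable {S : Type*} [TopologicalSpace S] {d : ℕ}

/-- A nonempty countable closed subset of a compact Hausdorff space has an isolated point. -/
theorem exists_isolated_of_countable {E : Type*} [TopologicalSpace E] [T2Space E] [CompactSpace E]
    {Y : Set E} (hc : IsClosed Y) (hne : Y.Nonempty) (hcount : Y.Countable) :
    ∃ z ∈ Y, ∃ W : Set E, IsOpen W ∧ z ∈ W ∧ ∀ y ∈ Y, y ∈ W → y = z := by
  have : CompactSpace Y := isCompact_iff_compactSpace.mp hc.isCompact
  have : Nonempty Y := hne.to_subtype
  have : Countable Y := hcount.to_subtype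
  obtain ⟨i, y, hy⟩ := nonempty_interior_of_iUnion_of_closed (f := fun i : Y => ({i} : Set Y))
    (fun i => isClosed_singleton) (by ext; simp)
  obtain ⟨t, ht, hto, hyt⟩ := mem_interior.mp hy
  obtain ⟨W, hW, rfl⟩ := isOpen_induced_iff.mp hto
  have hyi : y = i := ht hyt
  subst hyi
  refine ⟨y, y.2, W, hW, hyt, fun w hw hwW => ?_⟩
  exact congrArg Subtype.val (ht (show (⟨w, hw⟩ : Y) ∈ Subtype.val ⁻¹' W from hwW))

/-- Let `O` be an invariant set of configurations that is the maximal invariant subset of a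
neighbourhood `U`. A countable subshift that is not contained in `O` has a point outside `O` whose
orbit has only finitely many points outside each neighbourhood of `O`. -/
theorem exists_orbit_diff_finite [Finite S] [DiscreteTopology S] (X : Subshift S (Fin d → ℤ))
    (hcount : X.carrier.Countable) {O U : Set ((Fin d → ℤ) → S)}
    (hO : ∀ v, ∀ x ∈ O, shift v x ∈ O) (hU : IsOpen U)
    (hmax : ∀ x, (∀ v, shift v x ∈ U) → x ∈ O) (hOU : O ⊆ U) (hX : ¬ X.carrier ⊆ O) :
    ∃ z ∈ X.carrier, z ∉ O ∧
      ∀ W, IsOpen W → O ⊆ W → (Set.range (fun v => shift v z) \ W).Finite := by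
  let A : Set (Set ((Fin d → ℤ) → S)) :=
    {Y | IsClosed Y ∧ (∀ v, Set.MapsTo (shift v) Y Y) ∧ Y ⊆ X.carrier ∧ ¬ Y ⊆ O}
  -- Not being contained in `O` becomes meeting the closed complement of `U`, a condition that
  -- survives intersections of chains by compactness.
  have key : ∀ Y ∈ A, (Y \ U).Nonempty := by
    rintro Y ⟨-, hinv, -, hYO⟩
    obtain ⟨y, hy, hyO⟩ := Set.not_subset.mp hYO
    have : ∃ v, shift v y ∉ U := by
      by_contra! h
      exact hyO (hmax y h)
    obtain ⟨v, hv⟩ := this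
    exact ⟨_, hinv v hy, hv⟩
  obtain ⟨Y, hYX, hmin⟩ := zorn_superset_nonempty A (by
    intro c hcA hchain hcne
    refine ⟨⋂₀ c, ⟨isClosed_sInter fun s hs => (hcA hs).1, ?_, ?_, ?_⟩,
      fun s hs => Set.sInter_subset_of_mem hs⟩
    · intro v x hx s hs
      exact (hcA hs).2.1 v (hx s hs)
    · obtain ⟨s, hs⟩ := hcne
      exact (Set.sInter_subset_of_mem hs).trans (hcA hs).2.2.1
    · have : Nonempty c := hcne.to_subtype
      have h := IsCompact.nonempty_iInter_of_directed_nonempty_isCompact_isClosed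
        (fun s : c => (s : Set _) \ U) (by
          intro s t
          rcases hchain.total s.2 t.2 with h | h
          · exact ⟨s, subset_rfl, Set.sdiff_subset_sdiff_left h⟩
          · exact ⟨t, Set.sdiff_subset_sdiff_left h, subset_rfl⟩)
        (fun s => key _ (hcA s.2))
        (fun s => ((hcA s.2).1.sdiff hU).isCompact)
        (fun s => (hcA s.2).1.sdiff hU)
      obtain ⟨x, hx⟩ := h
      rw [Set.mem_iInter] at hx
      intro hsub
      refine (hx (Classical.arbitrary c)).2 (hOU (hsub ?_))
      exact fun s hs => (hx ⟨s, hs⟩).1) X.carrier ⟨X.isClosed, X.mapsTo, subset_rfl, hX⟩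
  obtain ⟨hYc, hYinv, -, hYO⟩ := hmin.prop
  obtain ⟨y₀, hy₀, hy₀O⟩ := Set.not_subset.mp hYO
  obtain ⟨z, hzY, I, hI, hzI, hIz⟩ :=
    exists_isolated_of_countable hYc ⟨y₀, hy₀⟩ (hcount.mono hYX)
  -- By minimality the orbit of `y` is dense in `Y`, so it meets the open set `I`, where `z` is the
  -- only point of `Y`.
  have horb : ∀ y ∈ Y, y ∉ O → ∃ v, shift v y = z := by
    intro y hy hyO
    have hsub : Set.range (fun v => shift v y) ⊆ Y := by
      rintro _ ⟨v, rfl⟩; exact hYinv v hy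
    have hcl : closure (Set.range (fun v => shift v y)) ⊆ Y := hYc.closure_subset_iff.mpr hsub
    have hmem : closure (Set.range (fun v => shift v y)) ∈ A := by
      refine ⟨isClosed_closure, fun v => ?_, hcl.trans hYX, fun h => hyO (h ?_)⟩
      · refine Set.MapsTo.closure ?_ (continuous_shift v)
        rintro _ ⟨w, rfl⟩
        exact ⟨w + v, shift_add _ _ _⟩
      · exact subset_closure ⟨0, shift_zero y⟩
    have hz := hmin.le_of_le hmem hcl hzY
    obtain ⟨_, hwI, v, rfl⟩ := mem_closure_iff.mp hz I hI hzI
    exact ⟨v, hIz _ (hYinv v hy) hwI⟩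
  refine ⟨z, hYX hzY, ?_, fun W hW hOW => ?_⟩
  · intro hzO
    obtain ⟨v, rfl⟩ := horb y₀ hy₀ hy₀O
    apply hy₀O
    rw [← shift_neg_shift v y₀]
    exact hO _ _ hzO
  · obtain ⟨t, ht⟩ := (hYc.sdiff hW).isCompact.elim_finite_subcover
      (fun v => shift v ⁻¹' I) (fun v => hI.preimage (continuous_shift v)) (by
        rintro y ⟨hy, hyW⟩
        obtain ⟨v, hv⟩ := horb y hy (fun h => hyW (hOW h))
        exact Set.mem_iUnion.mpr ⟨v, by rw [Set.mem_preimage, hv]; exact hzI⟩)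
    refine (t.finite_toSet.image (fun v => shift (-v) z)).subset ?_
    rintro _ ⟨⟨w, rfl⟩, hw⟩
    have hwY : shift w z ∈ Y := hYinv w hzY
    obtain ⟨v, hvt, hv⟩ := Set.mem_iUnion₂.mp (ht ⟨hwY, hw⟩)
    refine ⟨v, hvt, ?_⟩
    have heq := congrArg (shift (-v)) (hIz _ (hYinv v hwY) hv)
    rw [shift_neg_shift] at heq
    exact heq.symm

end Isolated

/-! ### Period lattices -/

section Periodic

variable {S : Type*}

/-- Invariance of a configuration under all translations by multiples of `r`. -/
def HasPeriod {d : ℕ} (r : ℤ) (x : (Fin d → ℤ) → S) : Prop :=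
  ∀ v w : Fin d → ℤ, x (v + r • w) = x v

theorem apply_add_zsmul {G : Type*} [AddGroup G] {x : G → S} {h : G}
    (hx : ∀ v, x (v + h) = x v) (k : ℤ) (v : G) : x (v + k • h) = x v := by
  induction k using Int.induction_on with
  | zero => simp
  | succ n ih => rw [add_zsmul, one_zsmul, ← add_assoc, hx, ih]
  | pred n ih =>
    rw [← hx, add_assoc, sub_zsmul, one_zsmul, neg_add_cancel_right, ih]

theorem IsPeriodic.exists_hasPeriod {x : (Fin 2 → ℤ) → S} (hx : IsPeriodic x) :
    ∃ r : ℤ, 0 < r ∧ HasPeriod r x := by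
  obtain ⟨r, hr, h⟩ := hx
  have hk : ∀ (k : Fin 2) v, x (v + Pi.single k (r : ℤ)) = x v := fun k v => by
    rw [add_comm]; exact congrFun (h k) v
  refine ⟨r, by exact_mod_cast hr, fun v w => ?_⟩
  have : (r : ℤ) • w = w 0 • Pi.single 0 (r : ℤ) + w 1 • Pi.single 1 (r : ℤ) := by
    ext i; fin_cases i <;> simp [mul_comm]
  rw [this, ← add_assoc, apply_add_zsmul (hk 1), apply_add_zsmul (hk 0)]

/-- Cramer's rule: the determinant times each unit vector is an integer combination of `h` and `u`.
-/
theorem isPeriodic_of_det_ne_zero {x : (Fin 2 → ℤ) → S} {h u : Fin 2 → ℤ}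
    (hh : ∀ v, x (v + h) = x v) (hu : ∀ v, x (v + u) = x v) (hD : h 0 * u 1 - h 1 * u 0 ≠ 0) :
    IsPeriodic x := by
  have hD0 : ∀ v, x (v + Pi.single 0 (h 0 * u 1 - h 1 * u 0)) = x v := fun v => by
    have : (Pi.single 0 (h 0 * u 1 - h 1 * u 0) : Fin 2 → ℤ) = u 1 • h + (-h 1) • u := by
      ext i; fin_cases i <;> simp <;> ring
    rw [this, ← add_assoc, apply_add_zsmul hu, apply_add_zsmul hh]
  have hD1 : ∀ v, x (v + Pi.single 1 (h 0 * u 1 - h 1 * u 0)) = x v := fun v => by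
    have : (Pi.single 1 (h 0 * u 1 - h 1 * u 0) : Fin 2 → ℤ) = h 0 • u + (-u 0) • h := by
      ext i; fin_cases i <;> simp <;> ring
    rw [this, ← add_assoc, apply_add_zsmul hh, apply_add_zsmul hu]
  generalize h 0 * u 1 - h 1 * u 0 = D at hD hD0 hD1
  have hDk : ∀ (k : Fin 2) v, x (v + Pi.single k D) = x v := fun k => by
    fin_cases k
    · exact hD0
    · exact hD1
  refine ⟨D.natAbs, Int.natAbs_pos.mpr hD, fun k => funext fun v => ?_⟩
  rw [shift_apply, add_comm]
  rcases Int.natAbs_eq D with h | h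
  · rw [← h]; exact hDk k v
  · have : ((D.natAbs : ℕ) : ℤ) = -D := by omega
    rw [this, Pi.single_neg, ← hDk k, neg_add_cancel_right]

theorem HasPeriod.shift {d : ℕ} {r : ℤ} {x : (Fin d → ℤ) → S} (hx : HasPeriod r x)
    (a : Fin d → ℤ) : HasPeriod r (shift a x) := fun v w => by
  simp only [shift_apply]; rw [← add_assoc, hx]

theorem HasPeriod.finite_orbit {d : ℕ} {r : ℤ} (hr : 0 < r) {x : (Fin d → ℤ) → S}
    (hx : HasPeriod r x) : (Set.range fun v => SymbolicDynamics.FullShift.shift v x).Finite := by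
  refine ((Set.finite_Icc (0 : Fin d → ℤ) (fun _ => r)).image
    (fun v => SymbolicDynamics.FullShift.shift v x)).subset ?_
  rintro _ ⟨v, rfl⟩
  refine ⟨fun i => v i % r, ⟨fun i => Int.emod_nonneg _ hr.ne',
    fun i => (Int.emod_lt_of_pos _ hr).le⟩, funext fun w => ?_⟩
  have : v + w = ((fun i => v i % r) + w) + r • (fun i => v i / r) := by
    ext i
    have := Int.emod_add_mul_ediv (v i) r
    simp only [Pi.add_apply, Pi.smul_apply, smul_eq_mul]; omega
  simp only [shift_apply]
  rw [this, hx]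

theorem HasPeriod.eq_of_eqOn_box {d : ℕ} {r : ℤ} (hr : 0 < r) {x y : (Fin d → ℤ) → S}
    (hx : HasPeriod r x) (hy : HasPeriod r y) (v : Fin d → ℤ)
    (h : ∀ w : Fin d → ℤ, (∀ i, 0 ≤ w i ∧ w i < r) → x (v + w) = y (v + w)) : x = y := by
  funext s
  have : s = (v + fun i => (s i - v i) % r) + r • (fun i => (s i - v i) / r) := by
    ext i
    have := Int.emod_add_mul_ediv (s i - v i) r
    simp only [Pi.add_apply, Pi.smul_apply, smul_eq_mul]; omega
  rw [this, hx, hy]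
  exact h _ fun i => ⟨Int.emod_nonneg _ hr.ne', Int.emod_lt_of_pos _ hr⟩

theorem HasPeriod.eq_of_eqOn_strip {d : ℕ} {r : ℤ} (hr : 0 < r) {x y : (Fin d → ℤ) → S}
    (hx : HasPeriod r x) (hy : HasPeriod r y) (f : (Fin d → ℤ) →+ ℤ) {g : Fin d → ℤ}
    (hg : 0 < f g) (A : ℤ) (h : ∀ v, A ≤ f v → f v < A + r * f g → x v = y v) : x = y := by
  funext s
  have hrg : 0 < r * f g := mul_pos hr hg
  have e : x s = x (s + r • (-((f s - A) / (r * f g)) • g)) := (hx _ _).symm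
  have e' : y s = y (s + r • (-((f s - A) / (r * f g)) • g)) := (hy _ _).symm
  have h1 := Int.emod_add_mul_ediv (f s - A) (r * f g)
  have h2 := Int.emod_nonneg (f s - A) hrg.ne'
  have h3 := Int.emod_lt_of_pos (f s - A) hrg
  have hf : f (s + r • (-((f s - A) / (r * f g)) • g)) = A + (f s - A) % (r * f g) := by
    rw [map_add, map_zsmul, map_zsmul, smul_eq_mul, smul_eq_mul]
    linear_combination -h1
  rw [e, e']
  apply h <;> rw [hf] <;> omega

end Periodic

/-! ### Half-planes that look locally like a periodic orbit -/

section Phase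

variable {S : Type*}

/-- The configurations that agree with a point of `O` on the box `[-R, R]ᵈ`. -/
def boxNhd {d : ℕ} (O : Set ((Fin d → ℤ) → S)) (R : ℤ) : Set ((Fin d → ℤ) → S) :=
  {x | ∃ q ∈ O, ∀ w : Fin d → ℤ, (∀ i, |w i| ≤ R) → x w = q w}

theorem subset_boxNhd {d : ℕ} (O : Set ((Fin d → ℤ) → S)) (R : ℤ) : O ⊆ boxNhd O R :=
  fun q hq => ⟨q, hq, fun _ _ => rfl⟩

theorem isOpen_boxNhd [TopologicalSpace S] [DiscreteTopology S] {d : ℕ}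
    (O : Set ((Fin d → ℤ) → S)) (R : ℤ) : IsOpen (boxNhd O R) := by
  have : boxNhd O R =
      ⋃ q ∈ O, cylinder (Finset.Icc (fun _ => -R : Fin d → ℤ) (fun _ => R)) q := by
    ext x
    simp only [boxNhd, Set.mem_ofPred_eq, Set.mem_iUnion, mem_cylinder, Finset.mem_Icc, Pi.le_def,
      abs_le, forall_and, exists_prop]
  rw [this]
  exact isOpen_biUnion fun q _ => isOpen_cylinder _ _

/-- `f` is monotone along a line, so the steps between two points of a half-plane stay in it. -/
theorem eq_add_zsmul_of_adjacent {α : Type*} {f : (Fin 2 → ℤ) →+ ℤ} {C : ℤ}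
    {φ : (Fin 2 → ℤ) → α} {e : Fin 2 → ℤ}
    (h : ∀ v, C < f v → C < f (v + e) → φ v = φ (v + e)) (v : Fin 2 → ℤ) (k : ℤ)
    (hv : C < f v) (hk : C < f (v + k • e)) : φ v = φ (v + k • e) := by
  have nat : ∀ (n : ℕ) (v : Fin 2 → ℤ), C < f v → C < f (v + (n : ℤ) • e) →
      φ v = φ (v + (n : ℤ) • e) := by
    intro n
    induction n with
    | zero => intro v _ _; simp
    | succ n ih =>
      intro v hv hn
      have hs : v + ((n + 1 : ℕ) : ℤ) • e = (v + (n : ℤ) • e) + e := by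
        push_cast; rw [add_zsmul, one_zsmul, add_assoc]
      have hmid : C < f (v + (n : ℤ) • e) := by
        rw [hs, map_add] at hn
        rw [map_add, map_zsmul, smul_eq_mul] at hn ⊢
        rcases le_or_gt 0 (f e) with he | he
        · have : 0 ≤ (n : ℤ) * f e := by positivity
          omega
        · omega
      rw [hs] at hn ⊢
      rw [ih v hv hmid, h _ hmid hn]
  rcases Int.eq_nat_or_neg k with ⟨n, rfl | rfl⟩
  · exact nat n v hv hk
  · have h2 : v + (-(n : ℤ)) • e + (n : ℤ) • e = v := by rw [neg_zsmul, neg_add_cancel_right]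
    have := nat n _ hk (by rwa [h2])
    rw [this, h2]

/-- Half-planes of the grid are connected. -/
theorem eq_of_adjacent_of_halfPlane {α : Type*} {f : (Fin 2 → ℤ) →+ ℤ} {C : ℤ}
    {φ : (Fin 2 → ℤ) → α}
    (h : ∀ (i : Fin 2) v, C < f v → C < f (v + Pi.single i 1) → φ v = φ (v + Pi.single i 1))
    {v v' : Fin 2 → ℤ} (hv : C < f v) (hv' : C < f v') : φ v = φ v' := by
  have e1 : v' = v + (v' 0 - v 0) • Pi.single 0 1 + (v' 1 - v 1) • Pi.single 1 1 := by
    ext i; fin_cases i <;> simp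
  have e2 : v' = v + (v' 1 - v 1) • Pi.single 1 1 + (v' 0 - v 0) • Pi.single 0 1 := by
    ext i; fin_cases i <;> simp
  generalize v' 0 - v 0 = a at e1 e2
  generalize v' 1 - v 1 = b at e1 e2
  have hf := congrArg f e1
  simp only [map_add] at hf
  -- The values of `f` at the two corners of the L-shaped paths add up to `f v + f v'`, so at least
  -- one corner lies in the half-plane.
  rcases lt_or_ge C (f (v + a • Pi.single 0 1)) with hm | hm
  · rw [eq_add_zsmul_of_adjacent (h 0) v a hv hm, e1]
    exact eq_add_zsmul_of_adjacent (h 1) _ b hm (e1 ▸ hv')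
  · have hm' : C < f (v + b • Pi.single 1 1) := by
      rw [map_add] at hm ⊢; omega
    rw [eq_add_zsmul_of_adjacent (h 1) v b hv hm', e2]
    exact eq_add_zsmul_of_adjacent (h 0) _ a hm' (e2 ▸ hv')

/-- A configuration that locally looks like points of `O` on a half-plane agrees with one point of
`O` there. -/
theorem exists_eqOn_halfPlane {r : ℤ} (hr : 0 < r) {O : Set ((Fin 2 → ℤ) → S)}
    (hO : ∀ v, ∀ x ∈ O, shift v x ∈ O) (hper : ∀ q ∈ O, HasPeriod r q) (hne : O.Nonempty)
    (f : (Fin 2 → ℤ) →+ ℤ) (C : ℤ) {x : (Fin 2 → ℤ) → S}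
    (hx : ∀ v, C < f v → shift v x ∈ boxNhd O r) :
    ∃ q ∈ O, ∀ v, C < f v → x v = q v := by
  have hφ : ∀ v, ∃ q ∈ O, C < f v → ∀ w : Fin 2 → ℤ, (∀ i, |w i| ≤ r) → x (v + w) = q (v + w) := by
    intro v
    by_cases hv : C < f v
    · obtain ⟨q, hq, h⟩ := hx v hv
      refine ⟨shift (-v) q, hO _ _ hq, fun _ w hw => ?_⟩
      rw [shift_apply, neg_add_cancel_left]
      exact h w hw
    · exact ⟨hne.some, hne.some_mem, fun h => absurd h hv⟩
  choose φ hφO hφ using hφ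
  by_cases hemp : ∃ v₀, C < f v₀
  · obtain ⟨v₀, hv₀⟩ := hemp
    refine ⟨φ v₀, hφO v₀, fun v hv => ?_⟩
    -- The boxes around neighbouring positions share a box of side `r`, which determines an
    -- `r`-periodic configuration; so the local choice `φ` is constant.
    have hadj : φ v₀ = φ v := by
      refine eq_of_adjacent_of_halfPlane (fun i v hv hv' => ?_) hv₀ hv
      refine HasPeriod.eq_of_eqOn_box hr (hper _ (hφO _)) (hper _ (hφO _)) (v + Pi.single i 1)
        fun w hw => ?_
      rw [← hφ _ hv' w fun j => abs_le.mpr ⟨by linarith [(hw j).1], (hw j).2.le⟩, add_assoc]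
      refine (hφ v hv _ fun j => ?_).symm
      have h01 : (Pi.single i 1 : Fin 2 → ℤ) j = 0 ∨ (Pi.single i 1 : Fin 2 → ℤ) j = 1 := by
        rcases eq_or_ne j i with rfl | hji
        · exact Or.inr (by simp)
        · exact Or.inl (by simp [hji])
      have := hw j
      rw [Pi.add_apply, abs_le]
      omega
    rw [hadj]
    simpa using hφ v hv 0 (by simpa using hr.le)
  · exact ⟨hne.some, hne.some_mem, fun v hv => absurd ⟨v, hv⟩ hemp⟩

/-- Supplies the maximality hypothesis of `exists_orbit_diff_finite`. The zero functional with bound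
`-1` turns the half-plane into the whole grid. -/
theorem mem_of_forall_shift_mem_boxNhd {r : ℤ} (hr : 0 < r) {O : Set ((Fin 2 → ℤ) → S)}
    (hO : ∀ v, ∀ x ∈ O, shift v x ∈ O) (hper : ∀ q ∈ O, HasPeriod r q) (hne : O.Nonempty)
    {x : (Fin 2 → ℤ) → S} (hx : ∀ v, shift v x ∈ boxNhd O r) : x ∈ O := by
  obtain ⟨q, hq, h⟩ := exists_eqOn_halfPlane hr hO hper hne 0 (-1) (x := x) fun v _ => hx v
  have : x = q := funext fun v => h v (by simp)
  rwa [this]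

end Phase

/-! ### Repeating a strip inside an SFT -/

section Glue

variable {S : Type*}

theorem exists_support_bound [Inhabited S] {d : ℕ} {F : Set (Pattern S (Fin d → ℤ))} (hF : F.Finite)
    (f : (Fin d → ℤ) →+ ℤ) : ∃ B : ℤ, 0 ≤ B ∧ ∀ p ∈ F, ∀ s ∈ p.support, |f s| ≤ B := by
  have hfin : (⋃ p ∈ F, (fun s => |f s|) '' (p.support : Set (Fin d → ℤ))).Finite :=
    hF.biUnion fun p _ => p.support.finite_toSet.image _
  obtain ⟨B, hB⟩ := hfin.bddAbove
  refine ⟨max B 0, le_max_right _ _, fun p hp s hs => le_max_of_le_left (hB ?_)⟩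
  exact Set.mem_biUnion hp ⟨s, hs, rfl⟩

/-- The `u`-periodic configuration that agrees with `x` on the strip `-a ≤ f v < f u - a`. -/
def glue {d : ℕ} (f : (Fin d → ℤ) →+ ℤ) (u : Fin d → ℤ) (a : ℤ) (x : (Fin d → ℤ) → S) :
    (Fin d → ℤ) → S :=
  fun v => x (v - ((f v + a) / f u) • u)

variable {d : ℕ} {f : (Fin d → ℤ) →+ ℤ} {u : Fin d → ℤ} {a : ℤ} {x : (Fin d → ℤ) → S}

theorem glue_add (hu : 0 < f u) (v : Fin d → ℤ) : glue f u a x (v + u) = glue f u a x v := by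
  unfold glue
  have : (f (v + u) + a) / f u = (f v + a) / f u + 1 := by
    rw [map_add, add_right_comm, Int.add_ediv_of_dvd_right dvd_rfl, Int.ediv_self hu.ne']
  rw [this, add_zsmul, one_zsmul, add_sub_add_right_eq_sub]

theorem glue_add_of_map_eq_zero {h : Fin d → ℤ} (hf : f h = 0) (hx : ∀ v, x (v + h) = x v)
    (v : Fin d → ℤ) : glue f u a x (v + h) = glue f u a x v := by
  unfold glue
  rw [map_add, hf, add_zero, add_sub_right_comm, hx]

theorem glue_of_ediv_eq {k : ℤ} {v : Fin d → ℤ} (h1 : k * f u ≤ f v + a)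
    (h2 : f v + a < (k + 1) * f u) (hu : 0 < f u) : glue f u a x v = x (v - k • u) := by
  have : (f v + a) / f u = k :=
    (Int.ediv_eq_iff_of_pos hu).mpr ⟨h1, by linarith⟩
  rw [glue, this]

theorem glue_eq {v : Fin d → ℤ} (h1 : -a ≤ f v) (h2 : f v < f u - a) :
    glue f u a x v = x v := by
  rw [glue_of_ediv_eq (k := 0) (by omega) (by omega) (by omega), zero_zsmul, sub_zero]

/-- A forbidden pattern placed at `v` can be moved by a multiple of `u` into the basic strip. It
then spills over a boundary by at most `B`, where `x` agrees with its translate by `u`, so it would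
occur in `x` itself. -/
theorem glue_mem_forbidden [Inhabited S] {F : Set (Pattern S (Fin d → ℤ))} {B : ℤ}
    (hB : ∀ p ∈ F, ∀ s ∈ p.support, |f s| ≤ B) (hBu : B ≤ f u) (hu : 0 < f u)
    (hx : x ∈ forbidden F)
    (hxu : ∀ t, -a - B ≤ f t → f t < -a + B → x (t + u) = x t) :
    glue f u a x ∈ forbidden F := by
  intro p hp v hv
  refine hx p hp (v - ((f v + a) / f u) • u) fun s hs => ?_
  rw [← hv s hs]
  have h1 := Int.emod_add_mul_ediv (f v + a) (f u)
  have h2 := Int.emod_nonneg (f v + a) hu.ne'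
  have h3 := Int.emod_lt_of_pos (f v + a) hu
  generalize (f v + a) / f u = k at *
  generalize (f v + a) % f u = m at *
  have hs' := abs_le.mp (hB p hp s hs)
  have hfs : f (v + s) + a = k * f u + m + f s := by rw [map_add]; linear_combination -h1
  have hft : f (v - k • u + s) = m + f s - a := by
    rw [map_add, map_sub, map_zsmul, smul_eq_mul]; linear_combination -h1
  rcases lt_or_ge (m + f s) 0 with h | h
  · rw [glue_of_ediv_eq (k := k - 1) (by linarith) (by linarith) hu, ← hxu _ (by omega) (by omega)]
    congr 1
    rw [sub_zsmul, one_zsmul]; abel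
  rcases lt_or_ge (m + f s) (f u) with h' | h'
  · rw [glue_of_ediv_eq (k := k) (by linarith) (by linarith) hu]
    congr 1
    abel
  · rw [glue_of_ediv_eq (k := k + 1) (by linarith) (by linarith) hu]
    have ht : v - k • u + s = (v + s - (k + 1) • u) + u := by
      rw [add_zsmul, one_zsmul]; abel
    rw [ht, map_add] at hft
    rw [ht, hxu _ (by omega) (by omega)]

end Glue

/-! ### Periodic points from strip-like and bounded defects -/

section Defects

variable {S : Type*}

/-- If `u` were parallel to the nonzero `h`, then `f` would vanish on `u` as well. -/
theorem det_ne_zero_of_map {f : (Fin 2 → ℤ) →+ ℤ} {h u : Fin 2 → ℤ} (hne : h ≠ 0) (hf : f h = 0)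
    (hu : f u ≠ 0) : h 0 * u 1 - h 1 * u 0 ≠ 0 := by
  have hlin : ∀ v : Fin 2 → ℤ, f v = v 0 * f (Pi.single 0 1) + v 1 * f (Pi.single 1 1) := by
    intro v
    have : v = v 0 • Pi.single 0 1 + v 1 • Pi.single 1 1 := by
      ext i; fin_cases i <;> simp
    conv_lhs => rw [this]
    rw [map_add, map_zsmul, map_zsmul, smul_eq_mul, smul_eq_mul]
  rw [hlin] at hf hu
  generalize f (Pi.single 0 1) = α at hf hu
  generalize f (Pi.single 1 1) = β at hf hu
  intro hD
  apply hne
  have h0 : h 0 * (u 0 * α + u 1 * β) = 0 := by linear_combination u 0 * hf + β * hD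
  have h1 : h 1 * (u 0 * α + u 1 * β) = 0 := by linear_combination u 1 * hf - α * hD
  ext i
  fin_cases i
  · exact (mul_eq_zero.mp h0).resolve_right hu
  · exact (mul_eq_zero.mp h1).resolve_right hu

variable [Inhabited S] {F : Set (Pattern S (Fin 2 → ℤ))} {r : ℤ} {p x : (Fin 2 → ℤ) → S}

/-- A singly periodic point of an SFT that on both sides of a strip agrees with translates of `p`
gives a doubly periodic point, obtained by repeating the strip. -/
theorem exists_isPeriodic_of_strip (hF : F.Finite) (hr : 0 < r) (hp : HasPeriod r p)
    (hx : x ∈ forbidden F) (hxp : x ∉ Set.range fun v => shift v p)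
    {f : (Fin 2 → ℤ) →+ ℤ} {h g : Fin 2 → ℤ} (hne : h ≠ 0) (hfh : f h = 0)
    (hxh : ∀ v, x (v + h) = x v) (hg : 0 < f g) {C : ℤ} (hC : 0 ≤ C) {a b : Fin 2 → ℤ}
    (ha : ∀ v, f v < -C → x v = shift a p v) (hb : ∀ v, C < f v → x v = shift b p v) :
    ∃ w ∈ forbidden F, w ∉ (Set.range fun v => shift v p) ∧ IsPeriodic w := by
  obtain ⟨B, hB0, hB⟩ := exists_support_bound hF f
  have hrg : 0 < r * f g := mul_pos hr hg
  -- The margin holds the defect `C`, the pattern range `B` and a full period `r * f g` on each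
  -- side, enough to recognise the phases there.
  obtain ⟨c, hc⟩ : ∃ c, c = B + C + r * f g := ⟨_, rfl⟩
  obtain ⟨n, hn⟩ : ∃ n : ℤ, n = |f (a - b)| + 2 * c + 1 := ⟨_, rfl⟩
  have hn0 : 0 ≤ n := by have := abs_nonneg (f (a - b)); omega
  have hu : 2 * c + 1 ≤ f (a - b + r • n • g) := by
    rw [map_add, map_zsmul, map_zsmul, smul_eq_mul, smul_eq_mul]
    have h1 : n ≤ r * (n * f g) := by nlinarith
    have := neg_abs_le (f (a - b))
    omega
  -- Modulo periods of `p`, translation by `u` matches the phase `b` above the strip with the phase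
  -- `a` below it; `n` makes `f u` large.
  obtain ⟨u, hu'⟩ : ∃ u, u = a - b + r • n • g := ⟨_, rfl⟩
  rw [← hu'] at hu
  have hab : ∀ t, shift b p (t + u) = shift a p t := by
    intro t
    have : b + (t + u) = (a + t) + r • n • g := by rw [hu']; abel
    rw [shift_apply, shift_apply, this, hp]
  have hw : glue f u c x ∈ forbidden F := by
    refine glue_mem_forbidden hB (by omega) (by omega) hx fun t h1 h2 => ?_
    rw [ha t (by omega), hb (t + u) (by rw [map_add]; omega), hab]
  refine ⟨_, hw, ?_, isPeriodic_of_det_ne_zero (h := h) (u := u)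
    (glue_add_of_map_eq_zero hfh hxh) (glue_add (by omega))
    (det_ne_zero_of_map hne hfh (by omega))⟩
  -- Were the glued point a translate of `p`, its phase would equal both `a` and `b`, and `x` would
  -- be a translate of `p` too.
  rintro ⟨e, he⟩
  have hstrip : ∀ v, -c ≤ f v → f v < f u - c → x v = shift e p v := fun v h1 h2 => by
    rw [← glue_eq (x := x) h1 h2]
    exact congrFun he.symm v
  have hea : shift e p = shift a p :=
    HasPeriod.eq_of_eqOn_strip hr (hp.shift e) (hp.shift a) f hg (-c) fun v h1 h2 => by
      rw [← hstrip v h1 (by omega), ha v (by omega)]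
  have heb : shift e p = shift b p :=
    HasPeriod.eq_of_eqOn_strip hr (hp.shift e) (hp.shift b) f hg (C + 1) fun v h1 h2 => by
      rw [← hstrip v (by omega) (by omega), hb v (by omega)]
  refine hxp ⟨e, funext fun v => ?_⟩
  change shift e p v = x v
  by_cases h1 : -c ≤ f v
  · by_cases h2 : f v < f u - c
    · exact (hstrip v h1 h2).symm
    · rw [heb, hb v (by omega)]
  · rw [hea, ha v (by omega)]

/-- The coordinate functionals of the grid. -/
def coord (i : Fin 2) : (Fin 2 → ℤ) →+ ℤ := Pi.evalAddMonoidHom _ i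

@[simp] theorem coord_apply (i : Fin 2) (v : Fin 2 → ℤ) : coord i v = v i := rfl

/-- A point of an SFT that differs from `p` in finitely many positions only gives a doubly periodic
point, obtained by repeating the defect. -/
theorem exists_isPeriodic_of_finite_diff (hF : F.Finite) (hr : 0 < r) (hp : HasPeriod r p)
    (hx : x ∈ forbidden F) (hxp : x ∉ Set.range fun v => shift v p) {C : ℤ} (hC : 0 ≤ C)
    {q : Fin 2 → ℤ} (hq : ∀ v i, C < |v i| → x v = shift q p v) :
    ∃ w ∈ forbidden F, w ∉ (Set.range fun v => shift v p) ∧ IsPeriodic w := by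
  obtain ⟨B, hB0, hB⟩ := exists_support_bound hF (coord 0)
  obtain ⟨c, hc⟩ : ∃ c, c = B + C := ⟨_, rfl⟩
  obtain ⟨n, hn⟩ : ∃ n : ℤ, n = 2 * c + 1 := ⟨_, rfl⟩
  obtain ⟨u, hu'⟩ : ∃ u : Fin 2 → ℤ, u = r • Pi.single 0 n := ⟨_, rfl⟩
  have hu0 : coord 0 u = r * n := by simp [hu']
  have hu1 : coord 1 u = 0 := by simp [hu']
  have hu : n ≤ coord 0 u := by rw [hu0]; nlinarith
  have hqu : ∀ k : ℤ, ∀ v, shift q p (v - k • u) = shift q p v := fun k v => by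
    have : v - k • u = v + r • (-k) • Pi.single 0 n := by
      rw [hu', smul_comm, neg_smul, smul_neg, sub_eq_add_neg, smul_comm]
    rw [this, hp.shift q]
  have hw : glue (coord 0) u c x ∈ forbidden F := by
    refine glue_mem_forbidden hB (by omega) (by omega) hx fun t h1 h2 => ?_
    rw [hq t 0 (lt_abs.mpr (Or.inr (by rw [coord_apply] at h2; omega))),
      hq (t + u) 0 (lt_abs.mpr (Or.inl (by
        rw [coord_apply] at h1 hu; rw [Pi.add_apply]; omega)))]
    have := hqu (-1) t
    rwa [neg_one_zsmul, sub_neg_eq_add] at this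
  have hout : ∀ v, C < |v 1| → glue (coord 0) u c x v = shift q p v := fun v hv => by
    have : (v - ((coord 0 v + c) / coord 0 u) • u) 1 = v 1 := by
      rw [coord_apply] at hu1
      rw [Pi.sub_apply, Pi.smul_apply, hu1, smul_zero, sub_zero]
    rw [glue, hq _ 1 (by rwa [this]), hqu]
  -- The row of copies of the defect is `u`-periodic and confined to a horizontal strip, so it can
  -- be stacked vertically.
  refine exists_isPeriodic_of_strip hF hr hp hw ?_ (f := coord 1) (h := u) (g := Pi.single 1 1)
    ?_ hu1 (glue_add (by omega)) (by simp) hC (a := q) (b := q)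
    (fun v hv => hout v (lt_abs.mpr (Or.inr (by rw [coord_apply] at hv; omega))))
    (fun v hv => hout v (lt_abs.mpr (Or.inl hv)))
  · rintro ⟨e, he⟩
    have heq : shift e p = shift q p :=
      HasPeriod.eq_of_eqOn_strip hr (hp.shift e) (hp.shift q) (coord 1) (g := Pi.single 1 1)
        (by simp) (C + 1) fun v h1 _ => by
          rw [← hout v (lt_abs.mpr (Or.inl (by rw [coord_apply] at h1; omega)))]
          exact congrFun he v
    refine hxp ⟨q, funext fun v => ?_⟩
    change shift q p v = x v
    by_cases h0 : -c ≤ coord 0 v ∧ coord 0 v < coord 0 u - c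
    · rw [← heq, ← glue_eq (x := x) h0.1 h0.2]
      exact congrFun he v
    · refine (hq v 0 (lt_abs.mpr ?_)).symm
      simp only [coord_apply] at h0 hu
      omega
  · rintro rfl
    rw [map_zero] at hu
    omega

end Defects

/-! ### The shape of a point whose orbit is almost near a periodic orbit -/

section Main

variable {S : Type*}

theorem range_shift_invariant {G : Type*} [AddGroup G] (p : G → S) (v : G) (x : G → S)
    (hx : x ∈ Set.range fun v => shift v p) : shift v x ∈ Set.range fun v => shift v p := by
  obtain ⟨w, rfl⟩ := hx
  exact ⟨w + v, shift_add _ _ _⟩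

/-- If `z` lies outside the orbit of the periodic point `p` and its orbit has finitely many points
outside a box neighbourhood of the orbit of `p`, then the SFT has a periodic point outside the orbit
of `p`. Indeed `z` either differs from a translate of `p` in finitely many positions only or agrees
with translates of `p` on both sides of a strip. -/
theorem exists_isPeriodic_of_orbit_diff_finite [Inhabited S] {F : Set (Pattern S (Fin 2 → ℤ))}
    {r : ℤ} {p z : (Fin 2 → ℤ) → S} (hF : F.Finite) (hr : 0 < r) (hp : HasPeriod r p)
    (hz : z ∈ forbidden F) (hzp : z ∉ Set.range fun v => shift v p)
    (hfin : (Set.range (fun v => shift v z) \ boxNhd (Set.range fun v => shift v p) r).Finite) :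
    ∃ w ∈ forbidden F, w ∉ (Set.range fun v => shift v p) ∧ IsPeriodic w := by
  have hhalf := fun (f : (Fin 2 → ℤ) →+ ℤ) (C : ℤ) => exists_eqOn_halfPlane hr
    (range_shift_invariant p) (by rintro _ ⟨v, rfl⟩; exact hp.shift v) (Set.range_nonempty _)
    f C (x := z)
  by_cases hstab : ∃ h : Fin 2 → ℤ, h ≠ 0 ∧ shift h z = z
  · obtain ⟨h, hne, hh⟩ := hstab
    have hzh : ∀ v, z (v + h) = z v := fun v => by rw [add_comm]; exact congrFun hh v
    by_cases hper : IsPeriodic z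
    · exact ⟨z, hz, hzp, hper⟩
    let f : (Fin 2 → ℤ) →+ ℤ := h 0 • coord 1 - h 1 • coord 0
    have hf : ∀ v, f v = h 0 * v 1 - h 1 * v 0 := fun v => by simp [f]
    -- All periods of `z` are parallel to `h`, so `f` is well defined on translates; finitely many
    -- exceptional translates then occupy a bounded range of `f`.
    have hfz : ∀ v v', shift v z = shift v' z → f v = f v' := by
      intro v v' hvv
      by_contra hcon
      refine hper (isPeriodic_of_det_ne_zero (h := h) (u := v - v') hzh (fun t => ?_) ?_)
      · have := congrFun hvv (-v' + t)
        simp only [shift_apply] at this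
        rw [show t + (v - v') = v + (-v' + t) by abel, this, add_neg_cancel_left]
      · rw [← hf, map_sub]
        omega
    have hbdd : ∃ C, 0 ≤ C ∧ ∀ v, C < |f v| → shift v z ∈ boxNhd (Set.range fun v => shift v p) r := by
      choose! σ hσ using fun y (hy : y ∈ Set.range fun v => shift v z) => hy
      obtain ⟨C, hC⟩ := (hfin.image (fun y => |f (σ y)|)).bddAbove
      refine ⟨max C 0, le_max_right _ _, fun v hv => ?_⟩
      by_contra hcon
      have h1 := hC ⟨_, ⟨⟨v, rfl⟩, hcon⟩, rfl⟩
      have h2 : f (σ (shift v z)) = f v := hfz _ _ (hσ _ ⟨v, rfl⟩)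
      simp only [h2] at h1
      exact absurd (h1.trans (le_max_left _ 0)) (not_le.mpr hv)
    obtain ⟨C, hC0, hC⟩ := hbdd
    obtain ⟨_, ⟨b, rfl⟩, hb⟩ := hhalf f C fun v hv => hC v (lt_abs.mpr (Or.inl hv))
    obtain ⟨_, ⟨a, rfl⟩, ha⟩ := hhalf (-f) C fun v hv => hC v (lt_abs.mpr (Or.inr hv))
    refine exists_isPeriodic_of_strip hF hr hp hz hzp (f := f) (h := h) (g := ![-h 1, h 0]) hne
      (by rw [hf]; ring) hzh ?_ hC0
      (fun v hv => ha v (by rw [AddMonoidHom.neg_apply]; omega)) hb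
    rw [hf]
    have : h 0 ≠ 0 ∨ h 1 ≠ 0 := by
      by_contra! h0
      exact hne (by ext i; fin_cases i; exacts [h0.1, h0.2])
    simp only [Matrix.cons_val_one, Matrix.cons_val_zero]
    rcases this with h0 | h0
    · nlinarith [sq_pos_of_ne_zero h0, sq_nonneg (h 1)]
    · nlinarith [sq_pos_of_ne_zero h0, sq_nonneg (h 0)]
  · push Not at hstab
    have hinj : Function.Injective fun v => shift v z := by
      intro v v' hvv
      by_contra hcon
      refine hstab (v - v') (sub_ne_zero.mpr hcon) (funext fun t => ?_)
      have := congrFun hvv (-v' + t)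
      simp only [shift_apply] at this
      rw [shift_apply, show v - v' + t = v + (-v' + t) by abel, this, add_neg_cancel_left]
    have hbdd : ∃ C, 0 ≤ C ∧ ∀ v i, C < |v i| →
        shift v z ∈ boxNhd (Set.range fun v => shift v p) r := by
      have hfin' := hfin.preimage hinj.injOn
      obtain ⟨C, hC⟩ := (hfin'.image (fun v => max |v 0| |v 1|)).bddAbove
      refine ⟨max C 0, le_max_right _ _, fun v i hv => ?_⟩
      by_contra hcon
      have h1 : max |v 0| |v 1| ≤ C := hC ⟨v, ⟨⟨v, rfl⟩, hcon⟩, rfl⟩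
      have h2 : |v i| ≤ max |v 0| |v 1| := by
        fin_cases i
        exacts [le_max_left _ _, le_max_right _ _]
      exact absurd ((h2.trans h1).trans (le_max_left _ 0)) (not_le.mpr hv)
    obtain ⟨C, hC0, hC⟩ := hbdd
    have hpos := fun i => hhalf (coord i) C fun v hv => hC v i (lt_abs.mpr (Or.inl hv))
    have hneg := fun i => hhalf (-coord i) C fun v hv => hC v i (lt_abs.mpr (Or.inr hv))
    have hP : ∀ i, ∃ a, ∀ v, C < v i → z v = shift a p v := fun i => by
      obtain ⟨_, ⟨a, rfl⟩, ha⟩ := hpos i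
      exact ⟨a, ha⟩
    have hN : ∀ i, ∃ a, ∀ v, C < -v i → z v = shift a p v := fun i => by
      obtain ⟨_, ⟨a, rfl⟩, ha⟩ := hneg i
      exact ⟨a, ha⟩
    choose a ha using hP
    choose b hb using hN
    -- Perpendicular half-planes overlap in a quadrant, which contains an `r`-box; so all four
    -- phases coincide.
    have h01 : shift (a 0) p = shift (a 1) p :=
      HasPeriod.eq_of_eqOn_box hr (hp.shift _) (hp.shift _) ![C + 1, C + 1] fun w hw => by
        rw [← ha 0 _ (by have := hw 0; simp; omega), ha 1 _ (by have := hw 1; simp; omega)]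
    have h10 : shift (b 0) p = shift (a 1) p :=
      HasPeriod.eq_of_eqOn_box hr (hp.shift _) (hp.shift _) ![-C - 1 - r, C + 1] fun w hw => by
        rw [← hb 0 _ (by have := hw 0; simp; omega), ha 1 _ (by have := hw 1; simp; omega)]
    have h11 : shift (b 1) p = shift (a 0) p :=
      HasPeriod.eq_of_eqOn_box hr (hp.shift _) (hp.shift _) ![C + 1, -C - 1 - r] fun w hw => by
        rw [← hb 1 _ (by have := hw 1; simp; omega), ha 0 _ (by have := hw 0; simp; omega)]
    refine exists_isPeriodic_of_finite_diff hF hr hp hz hzp hC0 (q := a 1) fun v i hv => ?_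
    rcases lt_abs.mp hv with hv | hv
    · rw [ha i v hv]
      fin_cases i
      exacts [congrFun h01 v, rfl]
    · rw [hb i v hv]
      fin_cases i
      exacts [congrFun h10 v, congrFun (h11.trans h01) v]

/-! ### Minimality of periodic points in the subpattern order -/

theorem mem_orbit_of_dominates [Inhabited S] {x y : (Fin 2 → ℤ) → S} (hx : IsPeriodic x)
    (h : Dominates x y) : y ∈ Set.range fun v => shift v x := by
  obtain ⟨r, hr, hxr⟩ := hx.exists_hasPeriod
  have hfin := hxr.finite_orbit hr
  by_contra hy
  have hdiff : ∀ q ∈ Set.range (fun v => shift v x), ∃ v, y v ≠ q v := fun q hq => by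
    by_contra! hcon
    exact hy ((funext hcon : y = q) ▸ hq)
  choose! σ hσ using hdiff
  classical
  -- One position of disagreement for each of the finitely many translates of `x`: the pattern of
  -- `y` on `U` cannot occur in `x`.
  let U : Finset (Fin 2 → ℤ) := hfin.toFinset.image σ
  let P : Pattern S (Fin 2 → ℤ) :=
    { config := fun g => if g ∈ U then y g else default
      support := U
      condition := fun g hg => if_neg hg }
  obtain ⟨v, hv⟩ := h P ⟨0, fun w hw => by simp [P, show w ∈ U from hw]⟩
  have hmem : shift v x ∈ Set.range fun v => shift v x := ⟨v, rfl⟩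
  have hU : σ (shift v x) ∈ U := Finset.mem_image_of_mem _ (hfin.mem_toFinset.mpr hmem)
  have := hv _ hU
  simp only [P, if_pos hU] at this
  exact hσ _ hmem this.symm

theorem dominates_shift [Inhabited S] {d : ℕ} (x : (Fin d → ℤ) → S) (v : Fin d → ℤ) :
    Dominates x (shift v x) := fun _ ⟨w, hw⟩ =>
  ⟨v + w, (Pattern.occursInAt_shift _ _ _ _).mp hw⟩

theorem dominates_shift_left [Inhabited S] {d : ℕ} (x : (Fin d → ℤ) → S) (v : Fin d → ℤ) :
    Dominates (shift v x) x := by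
  have := dominates_shift (shift v x) (-v)
  rwa [shift_neg_shift] at this

theorem equivalent_of_mem_orbit [Inhabited S] {d : ℕ} {p x y : (Fin d → ℤ) → S}
    (hx : x ∈ Set.range fun v => shift v p) (hy : y ∈ Set.range fun v => shift v p) :
    Equivalent x y := by
  obtain ⟨v, rfl⟩ := hx
  obtain ⟨w, rfl⟩ := hy
  exact ⟨fun P hP => dominates_shift_left p v P (dominates_shift p w P hP),
    fun P hP => dominates_shift_left p w P (dominates_shift p v P hP)⟩

theorem equivalent_of_dominates_of_isPeriodic [Inhabited S] {x y : (Fin 2 → ℤ) → S}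
    (hx : IsPeriodic x) (h : Dominates x y) : Equivalent x y :=
  equivalent_of_mem_orbit ⟨0, shift_zero x⟩ (mem_orbit_of_dominates hx h)

theorem isPeriodic_of_finite_orbit {z : (Fin 2 → ℤ) → S}
    (hz : (Set.range fun v => shift v z).Finite) : IsPeriodic z := by
  have key : ∀ e : Fin 2 → ℤ, ∃ n : ℤ, n ≠ 0 ∧ ∀ v, z (v + n • e) = z v := by
    intro e
    obtain ⟨m, -, n, -, hmn, heq⟩ := Set.infinite_univ.exists_ne_map_eq_of_mapsTo
      (f := fun n : ℤ => shift (n • e) z) (t := Set.range fun v => shift v z)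
      (fun n _ => ⟨n • e, rfl⟩) hz
    refine ⟨m - n, sub_ne_zero.mpr hmn, fun v => ?_⟩
    have := congrFun heq (-(n • e) + v)
    simp only [shift_apply] at this
    rw [show v + (m - n) • e = m • e + (-(n • e) + v) by rw [sub_zsmul]; abel, this,
      add_neg_cancel_left]
  obtain ⟨m, hm, hm'⟩ := key (Pi.single 0 1)
  obtain ⟨n, hn, hn'⟩ := key (Pi.single 1 1)
  exact isPeriodic_of_det_ne_zero hm' hn' (by simp [hm, hn])

/-! ### Existence of inequivalent periodic points -/

variable [Finite S] [TopologicalSpace S] [DiscreteTopology S]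

theorem exists_isPeriodic (X : Subshift S (Fin 2 → ℤ)) (hcount : X.carrier.Countable)
    (hne : X.carrier.Nonempty) : ∃ p ∈ X.carrier, IsPeriodic p := by
  obtain ⟨z, hz, -, hfin⟩ := exists_orbit_diff_finite X hcount (O := ∅) (U := ∅) (by simp)
    isOpen_empty (fun x hx => hx 0) subset_rfl
    (fun h => hne.ne_empty (Set.subset_empty_iff.mp h))
  exact ⟨z, hz, isPeriodic_of_finite_orbit (by simpa using hfin ∅ isOpen_empty subset_rfl)⟩

/-- A countable SFT with inequivalent points has inequivalent periodic points. -/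
theorem exists_isPeriodic_not_equivalent [Inhabited S] (X : Subshift S (Fin 2 → ℤ)) (hsft : IsSFT X)
    (hcount : X.carrier.Countable) [Nontrivial (SubpatternPoset X)] :
    ∃ x ∈ X.carrier, ∃ y ∈ X.carrier, IsPeriodic x ∧ IsPeriodic y ∧ ¬ Equivalent x y := by
  obtain ⟨F, hF, hXF⟩ := hsft
  obtain ⟨s, t, hst⟩ := exists_pair_ne (SubpatternPoset X)
  induction s using Antisymmetrization.ind with | _ s
  induction t using Antisymmetrization.ind with | _ t
  rw [Ne, toAntisymmetrization_eq_iff] at hst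
  obtain ⟨p, hpX, hp⟩ := exists_isPeriodic X hcount ⟨_, s.mem⟩
  obtain ⟨r, hr, hpr⟩ := hp.exists_hasPeriod
  have hinv := range_shift_invariant p
  obtain ⟨z, hzX, hzp, hfin⟩ := exists_orbit_diff_finite X hcount hinv (isOpen_boxNhd _ r)
    (fun x hx => mem_of_forall_shift_mem_boxNhd hr hinv
      (by rintro _ ⟨v, rfl⟩; exact hpr.shift v) (Set.range_nonempty _) hx)
    (subset_boxNhd _ r) (fun h => hst (equivalent_of_mem_orbit (h s.mem) (h t.mem)))
  obtain ⟨w, hw, hwp, hwper⟩ := exists_isPeriodic_of_orbit_diff_finite hF hr hpr (hXF ▸ hzX) hzp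
    (hfin _ (isOpen_boxNhd _ r) (subset_boxNhd _ r))
  exact ⟨p, hpX, w, hXF ▸ hw, hp, hwper, fun h => hwp (mem_orbit_of_dominates hp h.1)⟩

end Main

end SubpatternOrder

theorem mainTheorem8 {S : Type*} [Finite S] [Inhabited S] [TopologicalSpace S]
    [DiscreteTopology S] (X : Subshift S (Fin 2 → ℤ))
    (hsft : SubpatternOrder.IsSFT X) (hcount : X.carrier.Countable) :
    (Nontrivial (SubpatternOrder.SubpatternPoset X) →
      ∃ x ∈ X.carrier, ∃ y ∈ X.carrier,
        SubpatternOrder.IsPeriodic x ∧ SubpatternOrder.IsPeriodic y ∧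
          ¬ SubpatternOrder.Equivalent x y) ∧
    (∀ (L : Type*) [Lattice L] [Nontrivial L],
      IsEmpty (L ≃o SubpatternOrder.SubpatternPoset X)) := by
  refine ⟨fun _ => SubpatternOrder.exists_isPeriodic_not_equivalent X hsft hcount,
    fun L _ _ => ⟨fun e => ?_⟩⟩
  have : Nontrivial (SubpatternOrder.SubpatternPoset X) := e.symm.toEquiv.nontrivial
  obtain ⟨x, hx, y, hy, hxp, hyp, hxy⟩ :=
    SubpatternOrder.exists_isPeriodic_not_equivalent X hsft hcount
  let x' : SubpatternOrder.SubpatternPoset X :=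
    toAntisymmetrization (· ≤ ·) (⟨x, hx⟩ : SubpatternOrder.Point X)
  let y' : SubpatternOrder.SubpatternPoset X :=
    toAntisymmetrization (· ≤ ·) (⟨y, hy⟩ : SubpatternOrder.Point X)
  -- The meet lies below two minimal classes, hence equals both.
  have hmx : e (e.symm x' ⊓ e.symm y') ≤ x' := by
    rw [← e.le_symm_apply]; exact inf_le_left
  have hmy : e (e.symm x' ⊓ e.symm y') ≤ y' := by
    rw [← e.le_symm_apply]; exact inf_le_right
  generalize e (e.symm x' ⊓ e.symm y') = m at hmx hmy
  induction m using Antisymmetrization.ind with | _ m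
  rw [SubpatternOrder.toAntisymmetrization_le_iff] at hmx hmy
  have h1 := SubpatternOrder.equivalent_of_dominates_of_isPeriodic hxp hmx
  have h2 := SubpatternOrder.equivalent_of_dominates_of_isPeriodic hyp hmy
  exact hxy ⟨fun P hP => h1.1 P (h2.2 P hP), fun P hP => h2.1 P (h1.2 P hP)⟩
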